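/- Let $n\ge 1$ and let $X>0$ be a random variable (the service time), with $\mathbb E[X]\in(0,\infty]$. In the $(n,1)$ *fork-early-cancel system*, which starts empty at time $0$, each arriving job is forked into $n$ tasks that join first-come first-served queues, one at each of $n$ servers. As soon as one task of a job reaches the head of its queue and starts service, the other $n-1$ tasks of that job are cancelled and leave their queues immediately; if several tasks of the job would start service simultaneously, one of them, chosen uniformly at random, is retained. The service times are i.i.d. copies of $X$ across jobs and servers, the random choices are independent from job to job, and the arrivals, the service times and the choices are independent of one another. For $j=0,1,2,\dots$ the latency $T_j$ of job $j$ is the time from its arrival until its retained task has been served, and its computing cost $C_j$ is the total time that servers spend serving tasks of job $j$. The *long-run mean* of nonnegative quantities $Y_j$ attached to the jobs is $\limsup_{N\to\infty}\frac1N\sum_{j<N}\mathbb E[Y_j]\in[0,\infty]$, and their *steady-state law*, if it exists, is the weak limit of the law of $Y_j$ as $j\to\infty$. (a) For every arrival process, $\mathbb E[C_j]=\mathbb E[X]$ for every job $j$; in particular the long-run mean cost per job is $\mathbb E[X]$. (b) Suppose that the jobs arrive according to a Poisson process of rate $\lambda>0$, and consider an $M/G/n$ queue (Poisson arrivals of rate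 $\lambda$, independent i.i.d. service times distributed as $X$, $n$ servers, one central first-come first-served line, initially empty) with response times $T_j^{M/G/n}$. Then the two systems are equivalent: the sequence of the arrival, service-start and departure times of all jobs has the same joint law in both. Consequently $\mathbb E[T_j]=\mathbb E[T_j^{M/G/n}]$ for every $j$, the long-run mean latencies coincide, and a probability law $\nu$ on $\mathbb R$ is the steady-state law of $T_j$ if and only if it is the steady-state law of $T_j^{M/G/n}$. That is, $\mathbb E[T]=\mathbb E[T^{M/G/n}]$. -/

import Mathlib

open MeasureTheory ProbabilityTheory Filter Topology
open scoped ENNReal BoundedContinuousFunction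

noncomputable section

/-! ### The `(n,1)` fork-early-cancel system, along one sample path

Job `j` arrives at time `A j` and puts one task in the first-come first-served queue of each of the
`n` servers; `X j i` is the time server `i` needs for the task of job `j`. The system starts empty
at time `0`. As soon as one task of a job starts service, the other tasks of that job leave their
queues; if several tasks of the job would start simultaneously, on the servers in the set `s`, then
only the one on server `pick j s` is kept. -/
namespace ForkEarlyCancel

variable {n : ℕ} [NeZero n]

/-- A task that arrives at time `a` at server `i`, whose earlier tasks have all left by time `c i`,
is at the head of its queue, with the server available, from this time on. -/
def headTime (a : ℝ) (c : Fin n → ℝ) (i : Fin n) : ℝ := max a (c i)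

/-- The first time at which some task of the job can start service. -/
def firstHead (a : ℝ) (c : Fin n → ℝ) : ℝ :=
  Finset.univ.inf' Finset.univ_nonempty (headTime a c)

/-- The servers on which a task of the job can start service at that first time. -/
def tied (a : ℝ) (c : Fin n → ℝ) : Finset (Fin n) :=
  Finset.univ.filter fun i => headTime a c i = firstHead a c

/-- When the task on server `i` leaves: after its service on the retained server `w`, and at the
instant of cancellation on any other server. -/
def leaveTime (a : ℝ) (c x : Fin n → ℝ) (w i : Fin n) : ℝ :=
  if i = w then firstHead a c + x i else firstHead a c

/-- `clearTime A X pick j i`: the time by which all tasks of the jobs `0, …, j - 1` have left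
server `i`. -/
def clearTime (A : ℕ → ℝ) (X : ℕ → Fin n → ℝ) (pick : ℕ → Finset (Fin n) → Fin n) :
    ℕ → Fin n → ℝ
  | 0, _ => 0
  | j + 1, i =>
    max (clearTime A X pick j i)
      (leaveTime (A j) (clearTime A X pick j) (X j)
        (pick j (tied (A j) (clearTime A X pick j))) i)

/-- The server on which the task of job `j` is retained. -/
def winner (A : ℕ → ℝ) (X : ℕ → Fin n → ℝ) (pick : ℕ → Finset (Fin n) → Fin n) (j : ℕ) : Fin n :=
  pick j (tied (A j) (clearTime A X pick j))

/-- The time at which job `j` starts service. -/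
def start (A : ℕ → ℝ) (X : ℕ → Fin n → ℝ) (pick : ℕ → Finset (Fin n) → Fin n) (j : ℕ) : ℝ :=
  firstHead (A j) (clearTime A X pick j)

/-- The time at which job `j` is complete, that is, its retained task has been served. -/
def departure (A : ℕ → ℝ) (X : ℕ → Fin n → ℝ) (pick : ℕ → Finset (Fin n) → Fin n) (j : ℕ) : ℝ :=
  leaveTime (A j) (clearTime A X pick j) (X j) (winner A X pick j) (winner A X pick j)

/-- The latency of job `j`: the time from its arrival until it is served. -/
def latency (A : ℕ → ℝ) (X : ℕ → Fin n → ℝ) (pick : ℕ → Finset (Fin n) → Fin n) (j : ℕ) : ℝ :=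
  departure A X pick j - A j

/-- The computing cost of job `j`: the total time spent by the servers serving it. The server of a
task spends on it the time from the start of its service until the task leaves; for a task
cancelled on reaching the head of its queue, or before, this is no time at all. -/
def cost (A : ℕ → ℝ) (X : ℕ → Fin n → ℝ) (pick : ℕ → Finset (Fin n) → Fin n) (j : ℕ) : ℝ :=
  ∑ i : Fin n,
    (leaveTime (A j) (clearTime A X pick j) (X j) (winner A X pick j) i - start A X pick j)

end ForkEarlyCancel

/-! ### The `n`-server queue with one central first-come first-served line, along one sample path

Job `j` arrives at time `A j` and has service time `S j`. The system starts empty. -/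
namespace MultiServerQueue

/-- Job `j` starts service at the first time `t`, not before its own arrival and not before the
start of any earlier job, at which fewer than `n` of the earlier jobs are still in service. -/
def start (n : ℕ) (A S : ℕ → ℝ) (j : ℕ) : ℝ :=
  sInf {t : ℝ | A j ≤ t ∧ (∀ l : Fin j, start n A S l ≤ t) ∧
    (Finset.univ.filter fun l : Fin j => t < start n A S l + S l).card < n}
termination_by j
decreasing_by all_goals exact Fin.is_lt _

/-- The time at which job `j` has been served. -/
def departure (n : ℕ) (A S : ℕ → ℝ) (j : ℕ) : ℝ := start n A S j + S j

/-- The response time of job `j`. -/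
def responseTime (n : ℕ) (A S : ℕ → ℝ) (j : ℕ) : ℝ := departure n A S j - A j

end MultiServerQueue

/-! ### Stochastic assumptions -/

/-- The times between consecutive arrivals, the first one counted from time `0`. -/
def interarrival {Ω : Type*} (A : ℕ → Ω → ℝ) : ℕ → Ω → ℝ
  | 0 => A 0
  | j + 1 => fun ω => A (j + 1) ω - A j ω

/-- `A j`, `j = 0, 1, …`, are the successive points of a Poisson process of rate `lam` on `[0, ∞)`:
the interarrival times are i.i.d. exponential of parameter `lam`. -/
structure IsPoissonArrivals {Ω : Type*} [MeasurableSpace Ω] (P : Measure Ω) (lam : ℝ)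
    (A : ℕ → Ω → ℝ) : Prop where
  measurable : ∀ j, Measurable (A j)
  indep : iIndepFun (interarrival A) P
  law : ∀ j, P.map (interarrival A j) = expMeasure lam

/-- The random data of a fork-early-cancel system with service time law `μ`: an arbitrary arrival
process `A`, service times `X` that are i.i.d. of law `μ` across jobs and servers, and choices
`pick` that are uniform on each nonempty set of tied servers and independent from job to job; the
arrivals, the service times and the choices are independent of one another. -/
structure IsForkEarlyCancelInput {Ω : Type*} [MeasurableSpace Ω] (P : Measure Ω) {n : ℕ}
    (μ : Measure ℝ) (A : ℕ → Ω → ℝ) (X : ℕ → Fin n → Ω → ℝ)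
    (pick : ℕ → Ω → Finset (Fin n) → Fin n) : Prop where
  measurable_arrival : ∀ j, Measurable (A j)
  arrival_nonneg : ∀ᵐ ω ∂P, 0 ≤ A 0 ω
  arrival_mono : ∀ᵐ ω ∂P, Monotone fun j => A j ω
  measurable_service : ∀ j i, Measurable (X j i)
  law_service : ∀ j i, P.map (X j i) = μ
  indep_service : iIndepFun (fun (p : ℕ × Fin n) ω => X p.1 p.2 ω) P
  measurable_pick : ∀ j, Measurable (pick j)
  law_pick : ∀ j (s : Finset (Fin n)), s.Nonempty →
    P.map (fun ω => pick j ω s) = uniformOn (s : Set (Fin n))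
  indep_pick : iIndepFun pick P
  indep_service_pick : IndepFun (fun ω j i => X j i ω) (fun ω j => pick j ω) P
  indep_arrival : IndepFun (fun ω j => A j ω)
    (fun ω => ((fun j i => X j i ω : ℕ → Fin n → ℝ),
      (fun j => pick j ω : ℕ → Finset (Fin n) → Fin n))) P

/-- The random data of an `M/G/n` queue with arrival rate `lam` and service time law `μ`: Poisson
arrivals and, independently of them, i.i.d. service times of law `μ`. -/
structure IsMGInput {Ω : Type*} [MeasurableSpace Ω] (P : Measure Ω) (lam : ℝ) (μ : Measure ℝ)
    (A S : ℕ → Ω → ℝ) : Prop where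
  poisson : IsPoissonArrivals P lam A
  measurable_service : ∀ j, Measurable (S j)
  law_service : ∀ j, P.map (S j) = μ
  indep_service : iIndepFun S P
  indep_arrival : IndepFun (fun ω j => A j ω) (fun ω j => S j ω) P

/-! ### Means and steady state -/

/-- The expectation, in `[0, ∞]`, of a random variable that is almost surely nonnegative. -/
def mean {Ω : Type*} [MeasurableSpace Ω] (P : Measure Ω) (Y : Ω → ℝ) : ℝ≥0∞ :=
  ∫⁻ ω, ENNReal.ofReal (Y ω) ∂P

/-- The long-run mean per job of the quantity `Y j` attached to the jobs `j = 0, 1, …`: the limit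
(in general the upper limit) of the mean over the first `N` jobs. -/
def longRunMean {Ω : Type*} [MeasurableSpace Ω] (P : Measure Ω) (Y : ℕ → Ω → ℝ) : ℝ≥0∞ :=
  limsup (fun N : ℕ => (∑ j ∈ Finset.range N, mean P (Y j)) / (N : ℝ≥0∞)) atTop

/-- `ν` is the steady-state law of `Y j`: the weak limit of the law of `Y j` as `j → ∞`. -/
def IsSteadyStateLaw {Ω : Type*} [MeasurableSpace Ω] (P : Measure Ω) (Y : ℕ → Ω → ℝ)
    (ν : Measure ℝ) : Prop :=
  IsProbabilityMeasure ν ∧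
    ∀ f : ℝ →ᵇ ℝ, Tendsto (fun j => ∫ ω, f (Y j ω) ∂P) atTop (𝓝 (∫ x, f x ∂ν))

/-! ### The latency and cost of the random systems -/

/-- The latency of job `j` in the random fork-early-cancel system. -/
def forkLatency {Ω : Type*} {n : ℕ} [NeZero n] (A : ℕ → Ω → ℝ) (X : ℕ → Fin n → Ω → ℝ)
    (pick : ℕ → Ω → Finset (Fin n) → Fin n) (j : ℕ) (ω : Ω) : ℝ :=
  ForkEarlyCancel.latency (fun j => A j ω) (fun j i => X j i ω) (fun j => pick j ω) j

/-- The computing cost of job `j` in the random fork-early-cancel system. -/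
def forkCost {Ω : Type*} {n : ℕ} [NeZero n] (A : ℕ → Ω → ℝ) (X : ℕ → Fin n → Ω → ℝ)
    (pick : ℕ → Ω → Finset (Fin n) → Fin n) (j : ℕ) (ω : Ω) : ℝ :=
  ForkEarlyCancel.cost (fun j => A j ω) (fun j i => X j i ω) (fun j => pick j ω) j

/-- Arrival, start and departure times of all jobs in the random fork-early-cancel system. -/
def forkHistory {Ω : Type*} {n : ℕ} [NeZero n] (A : ℕ → Ω → ℝ) (X : ℕ → Fin n → Ω → ℝ)
    (pick : ℕ → Ω → Finset (Fin n) → Fin n) (ω : Ω) : ℕ → ℝ × ℝ × ℝ := fun j =>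
  (A j ω,
    ForkEarlyCancel.start (fun j => A j ω) (fun j i => X j i ω) (fun j => pick j ω) j,
    ForkEarlyCancel.departure (fun j => A j ω) (fun j i => X j i ω) (fun j => pick j ω) j)

/-- The response time of job `j` in the random `n`-server queue. -/
def queueResponse {Ω : Type*} (n : ℕ) (A S : ℕ → Ω → ℝ) (j : ℕ) (ω : Ω) : ℝ :=
  MultiServerQueue.responseTime n (fun j => A j ω) (fun j => S j ω) j

/-- Arrival, start and departure times of all jobs in the random `n`-server queue. -/
def queueHistory {Ω : Type*} (n : ℕ) (A S : ℕ → Ω → ℝ) (ω : Ω) : ℕ → ℝ × ℝ × ℝ := fun j =>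
  (A j ω,
    MultiServerQueue.start n (fun j => A j ω) (fun j => S j ω) j,
    MultiServerQueue.departure n (fun j => A j ω) (fun j => S j ω) j)

end

/-! Let `S j` be the service time of job `j` on the server that keeps its task. Both claims reduce
to two facts about `S`.

Pathwise: cancelled tasks use no server time, so the cost of job `j` is `S j`, and the system
behaves as a central queue fed with `S`. Once jobs `0, …, j - 1` have started, each job in service
occupies exactly one server (`card_in_service`), so "fewer than `n` jobs in service" means "some
server is clear". The two recursions for the starting times then agree (`start_eq_queue_start`).

In law: the retained server of job `N` is determined by the arrivals, the choices and the service
times of earlier jobs, all independent of each `X N i`. Selecting the server therefore does not bias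
the service time: given the arrivals and the earlier `S j`, `S N` still has law `μ`
(`measure_inter_forkService`). Hence `S` is i.i.d. of law `μ` and independent of the arrivals, which
gives (a). For Poisson arrivals the pair of arrivals and `S` has the same law as the input of the
`M/G/n` queue. Histories are almost surely one measurable function of that pair, which gives (b). -/

theorem card_filter_univ_lt_iff {n : ℕ} (p : Fin n → Prop) [DecidablePred p] :
    (Finset.univ.filter p).card < n ↔ ∃ i, ¬ p i := by
  have h := Finset.card_lt_iff_ne_univ (Finset.univ.filter p)
  rw [Fintype.card_fin] at h
  simp [h, Finset.filter_eq_self]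

/-! ### Pathwise comparison with the central queue -/

namespace ForkEarlyCancel

variable {n : ℕ} [NeZero n]

/-- The service time of job `j` on the server where its task is retained. -/
noncomputable def service (A : ℕ → ℝ) (X : ℕ → Fin n → ℝ) (pick : ℕ → Finset (Fin n) → Fin n) (j : ℕ) : ℝ :=
  X j (winner A X pick j)

theorem firstHead_le_iff {a t : ℝ} {c : Fin n → ℝ} :
    firstHead a c ≤ t ↔ a ≤ t ∧ ∃ i, c i ≤ t := by
  simp [firstHead, headTime, Finset.inf'_le_iff]

theorem tied_nonempty (a : ℝ) (c : Fin n → ℝ) : (tied a c).Nonempty := by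
  obtain ⟨i, -, hi⟩ := Finset.exists_mem_eq_inf' Finset.univ_nonempty (headTime a c)
  exact ⟨i, by simp [tied, firstHead, hi]⟩

section Path

variable {A : ℕ → ℝ} {X : ℕ → Fin n → ℝ} {pick : ℕ → Finset (Fin n) → Fin n}

theorem departure_eq (A : ℕ → ℝ) (X : ℕ → Fin n → ℝ) (pick : ℕ → Finset (Fin n) → Fin n)
    (j : ℕ) : departure A X pick j = start A X pick j + service A X pick j := by
  simp [departure, leaveTime, start, service]

theorem cost_eq_service (A : ℕ → ℝ) (X : ℕ → Fin n → ℝ) (pick : ℕ → Finset (Fin n) → Fin n)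
    (j : ℕ) : cost A X pick j = service A X pick j := by
  rw [cost, Finset.sum_eq_single (winner A X pick j)]
  · simp [leaveTime, start, service]
  · intro i _ hi
    simp [leaveTime, hi, start]
  · simp

/-- The choice lies in the tied set, so the retained server attains the minimal head time. -/
theorem clearTime_winner_le (hp : ∀ j s, s.Nonempty → pick j s ∈ s) (j : ℕ) :
    clearTime A X pick j (winner A X pick j) ≤ start A X pick j := by
  have h := hp j _ (tied_nonempty (A j) (clearTime A X pick j))
  have h' : headTime (A j) (clearTime A X pick j) (winner A X pick j) = start A X pick j := by
    exact (Finset.mem_filter.1 h).2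
  exact h' ▸ le_max_right _ _

theorem clearTime_succ_winner (A : ℕ → ℝ) (X : ℕ → Fin n → ℝ)
    (pick : ℕ → Finset (Fin n) → Fin n) (j : ℕ) :
    clearTime A X pick (j + 1) (winner A X pick j) =
      max (clearTime A X pick j (winner A X pick j))
        (start A X pick j + service A X pick j) := by
  simp [clearTime, leaveTime, winner, start, service]

theorem clearTime_succ_of_ne {j : ℕ} {i : Fin n} (h : i ≠ winner A X pick j) :
    clearTime A X pick (j + 1) i = max (clearTime A X pick j i) (start A X pick j) := by
  have h' : i ≠ pick j (tied (A j) (clearTime A X pick j)) := h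
  simp [clearTime, leaveTime, start, h']

/-- Every queue holds a task of job `j` until that job starts, so no server is clear for job `j + 1`
earlier. -/
theorem start_monotone (hX : ∀ j i, 0 ≤ X j i) : Monotone (start A X pick) := by
  refine monotone_nat_of_le_succ fun j => ?_
  refine Finset.le_inf' Finset.univ_nonempty _ fun i _ => le_max_of_le_right ?_
  by_cases h : i = winner A X pick j
  · rw [h, clearTime_succ_winner]
    exact le_max_of_le_right (le_add_of_nonneg_right (hX _ _))
  · rw [clearTime_succ_of_ne h]
    exact le_max_right _ _

/-- Once the first `j` jobs have all started, the number of them still in service is the number of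
servers that they have not left yet. -/
theorem card_in_service (hp : ∀ j s, s.Nonempty → pick j s ∈ s) {t : ℝ} (ht : 0 ≤ t) (j : ℕ)
    (hs : ∀ l < j, start A X pick l ≤ t) :
    ((Finset.range j).filter fun l => t < departure A X pick l).card =
      (Finset.univ.filter fun i => t < clearTime A X pick j i).card := by
  induction j with
  | zero => simp [clearTime, not_lt.2 ht]
  | succ j ih =>
    have ih := ih fun l hl => hs l (hl.trans j.lt_succ_self)
    -- At a time `t` not before the start of job `j`, cancelled tasks have already left, so job `j`
    -- can change the status of the retained server only, and that server was clear before.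
    have hj := hs j j.lt_succ_self
    have hw := (clearTime_winner_le (A := A) (X := X) hp j).trans hj
    have hne : ∀ i, i ≠ winner A X pick j →
        (t < clearTime A X pick (j + 1) i ↔ t < clearTime A X pick j i) := fun i hi => by
      rw [clearTime_succ_of_ne hi, lt_max_iff, or_iff_left (not_lt.2 hj)]
    have hwin : t < clearTime A X pick (j + 1) (winner A X pick j) ↔
        t < departure A X pick j := by
      rw [clearTime_succ_winner, lt_max_iff, or_iff_right (not_lt.2 hw), departure_eq]
    rw [Finset.range_add_one, Finset.filter_insert]
    by_cases hd : t < departure A X pick j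
    · rw [if_pos hd, Finset.card_insert_of_notMem (by simp), ih]
      rw [← Finset.card_insert_of_notMem (a := winner A X pick j) (by simpa using hw)]
      congr 1
      ext i
      by_cases hi : i = winner A X pick j
      · simp [hi, hwin, hd]
      · simp [hi, hne i hi]
    · rw [if_neg hd, ih]
      congr 1
      ext i
      by_cases hi : i = winner A X pick j
      · simp [hi, hwin, hd, hw]
      · simp [hne i hi]

/-- Along a sample path, the fork-early-cancel system is the queue with a central line in which the
service time of a job is that of its retained task. -/
theorem start_eq_queue_start (hA : ∀ j, 0 ≤ A j) (hX : ∀ j i, 0 ≤ X j i)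
    (hp : ∀ j s, s.Nonempty → pick j s ∈ s) (j : ℕ) :
    MultiServerQueue.start n A (service A X pick) j = start A X pick j := by
  induction j using Nat.strong_induction_on with
  | _ j ih =>
    rw [MultiServerQueue.start]
    -- The admissible times form a closed half-line, so the infimum is its left endpoint.
    have key : {t : ℝ | A j ≤ t ∧
        (∀ l : Fin j, MultiServerQueue.start n A (service A X pick) l ≤ t) ∧
        (Finset.univ.filter fun l : Fin j =>
          t < MultiServerQueue.start n A (service A X pick) l + service A X pick l).card < n} =
        Set.Ici (start A X pick j) := by
      ext t
      have hcard (hs : ∀ l < j, start A X pick l ≤ t) (ht : A j ≤ t) :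
          (Finset.univ.filter fun l : Fin j =>
            t < MultiServerQueue.start n A (service A X pick) l + service A X pick l).card < n ↔
          ∃ i, clearTime A X pick j i ≤ t := by
        have h1 : (Finset.univ.filter fun l : Fin j =>
            t < MultiServerQueue.start n A (service A X pick) l + service A X pick l).card =
            ((Finset.range j).filter fun l => t < departure A X pick l).card := by
          rw [← Finset.card_map Fin.valEmbedding]
          congr 1
          ext l
          simp only [Finset.mem_map, Finset.mem_filter, Finset.mem_univ, true_and,
            Finset.mem_range, Fin.valEmbedding_apply]
          constructor
          · rintro ⟨k, hk, rfl⟩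
            rw [ih k k.2] at hk
            exact ⟨k.2, by rwa [departure_eq]⟩
          · rintro ⟨hl, hd⟩
            refine ⟨⟨l, hl⟩, ?_, rfl⟩
            rwa [ih l hl, ← departure_eq]
        rw [h1, card_in_service hp ((hA j).trans ht) j hs]
        simpa using card_filter_univ_lt_iff fun i => t < clearTime A X pick j i
      simp only [Set.mem_ofPred_eq, Set.mem_Ici]
      constructor
      · rintro ⟨h1, h2, h3⟩
        have hs : ∀ l < j, start A X pick l ≤ t := fun l hl => ih l hl ▸ h2 ⟨l, hl⟩
        exact firstHead_le_iff.2 ⟨h1, (hcard hs h1).1 h3⟩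
      · intro h
        have hs : ∀ l < j, start A X pick l ≤ t := fun l hl =>
          (start_monotone hX hl.le).trans h
        obtain ⟨h1, h3⟩ := firstHead_le_iff.1 h
        exact ⟨h1, fun l => (ih l l.2).symm ▸ hs l l.2, (hcard hs h1).2 h3⟩
    rw [key, csInf_Ici]

end Path

end ForkEarlyCancel

/-! ### Measurability and non-anticipation -/

namespace ForkEarlyCancel

variable {n : ℕ} [NeZero n]

section Measurability

variable {Ω : Type*} [MeasurableSpace Ω] {A : ℕ → Ω → ℝ} {X : ℕ → Fin n → Ω → ℝ}
  {pick : ℕ → Ω → Finset (Fin n) → Fin n}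

theorem measurable_firstHead {a : Ω → ℝ} {c : Ω → Fin n → ℝ} (ha : Measurable a)
    (hc : Measurable c) : Measurable fun ω => firstHead (a ω) (c ω) := by
  refine measurable_of_Iic fun t => ?_
  have h : (fun ω => firstHead (a ω) (c ω)) ⁻¹' Set.Iic t =
      a ⁻¹' Set.Iic t ∩ ⋃ i, (fun ω => c ω i) ⁻¹' Set.Iic t := by
    ext ω
    simp [firstHead_le_iff]
  rw [h]
  exact (ha measurableSet_Iic).inter
    (MeasurableSet.iUnion fun i => measurable_pi_iff.1 hc i measurableSet_Iic)

theorem measurableSet_tied_eq {a : Ω → ℝ} {c : Ω → Fin n → ℝ} (ha : Measurable a)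
    (hc : Measurable c) (s : Finset (Fin n)) : MeasurableSet {ω | tied (a ω) (c ω) = s} := by
  have h : {ω | tied (a ω) (c ω) = s} =
      {ω | ∀ i, headTime (a ω) (c ω) i = firstHead (a ω) (c ω) ↔ i ∈ s} := by
    ext ω
    simp [tied, Finset.ext_iff]
  rw [h, Set.ofPred_forall]
  refine MeasurableSet.iInter fun i => ?_
  have hi : MeasurableSet {ω | headTime (a ω) (c ω) i = firstHead (a ω) (c ω)} :=
    measurableSet_eq_fun (ha.max (measurable_pi_iff.1 hc i)) (measurable_firstHead ha hc)
  exact hi.iff (MeasurableSet.const _)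

/-- The choice is evaluated at a random set; splitting over the finitely many values of that set
leaves evaluations at fixed sets. -/
theorem measurable_pick_tied {a : Ω → ℝ} {c : Ω → Fin n → ℝ} {p : Ω → Finset (Fin n) → Fin n}
    (ha : Measurable a) (hc : Measurable c) (hp : Measurable p) :
    Measurable fun ω => p ω (tied (a ω) (c ω)) := by
  refine measurable_to_countable' fun w => ?_
  have h : (fun ω => p ω (tied (a ω) (c ω))) ⁻¹' {w} =
      ⋃ s : Finset (Fin n), {ω | tied (a ω) (c ω) = s} ∩ (fun ω => p ω s) ⁻¹' {w} := by
    ext ω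
    simp
  rw [h]
  exact MeasurableSet.iUnion fun s => (measurableSet_tied_eq ha hc s).inter
    (measurable_pi_iff.1 hp s (measurableSet_singleton w))

theorem measurable_clearTime (hA : ∀ j, Measurable (A j)) (hX : ∀ j i, Measurable (X j i))
    (hp : ∀ j, Measurable (pick j)) (j : ℕ) :
    Measurable fun ω => clearTime (fun j => A j ω) (fun j i => X j i ω) (fun j => pick j ω) j := by
  induction j with
  | zero => exact measurable_const
  | succ j ih =>
    refine measurable_pi_iff.2 fun i => (measurable_pi_iff.1 ih i).max ?_
    have hf := measurable_firstHead (hA j) ih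
    refine Measurable.ite ?_ (hf.add (hX j i)) hf
    exact measurableSet_eq_fun measurable_const (measurable_pick_tied (hA j) ih (hp j))

theorem measurable_winner (hA : ∀ j, Measurable (A j)) (hX : ∀ j i, Measurable (X j i))
    (hp : ∀ j, Measurable (pick j)) (j : ℕ) :
    Measurable fun ω => winner (fun j => A j ω) (fun j i => X j i ω) (fun j => pick j ω) j :=
  measurable_pick_tied (hA j) (measurable_clearTime hA hX hp j) (hp j)

theorem measurable_start (hA : ∀ j, Measurable (A j)) (hX : ∀ j i, Measurable (X j i))
    (hp : ∀ j, Measurable (pick j)) (j : ℕ) :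
    Measurable fun ω => start (fun j => A j ω) (fun j i => X j i ω) (fun j => pick j ω) j :=
  measurable_firstHead (hA j) (measurable_clearTime hA hX hp j)

theorem measurable_service (hA : ∀ j, Measurable (A j)) (hX : ∀ j i, Measurable (X j i))
    (hp : ∀ j, Measurable (pick j)) (j : ℕ) :
    Measurable fun ω => service (fun j => A j ω) (fun j i => X j i ω) (fun j => pick j ω) j := by
  have h : (fun ω => service (fun j => A j ω) (fun j i => X j i ω) (fun j => pick j ω) j) =
      fun ω => ∑ i, if i = winner (fun j => A j ω) (fun j i => X j i ω) (fun j => pick j ω) j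
        then X j i ω else 0 := by
    ext ω
    simp [service]
  rw [h]
  refine Finset.measurable_sum _ fun i _ => Measurable.ite ?_ (hX j i) measurable_const
  exact measurableSet_eq_fun measurable_const (measurable_winner hA hX hp j)

theorem measurable_departure (hA : ∀ j, Measurable (A j)) (hX : ∀ j i, Measurable (X j i))
    (hp : ∀ j, Measurable (pick j)) (j : ℕ) :
    Measurable fun ω => departure (fun j => A j ω) (fun j i => X j i ω) (fun j => pick j ω) j := by
  simp only [departure_eq]
  exact (measurable_start hA hX hp j).add (measurable_service hA hX hp j)

end Measurability

section Truncation

/-- The service times of the jobs `0, …, N - 1`, extended by zero. -/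
def truncateService (N : ℕ) (X : ℕ → Fin n → ℝ) : ℕ → Fin n → ℝ :=
  fun j i => if j < N then X j i else 0

variable (A : ℕ → ℝ) (X : ℕ → Fin n → ℝ) (pick : ℕ → Finset (Fin n) → Fin n)

theorem clearTime_truncateService {j N : ℕ} (h : j ≤ N) :
    clearTime A (truncateService N X) pick j = clearTime A X pick j := by
  induction j with
  | zero => rfl
  | succ j ih =>
    ext i
    have hX : truncateService N X j = X j := by
      ext i
      simp [truncateService, Nat.lt_of_succ_le h]
    simp only [clearTime, ih (Nat.le_of_succ_le h), hX]

/-- The case `j = N` is the one that matters: the server of job `N` is chosen without knowledge of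
its own service times. -/
theorem winner_truncateService {j N : ℕ} (h : j ≤ N) :
    winner A (truncateService N X) pick j = winner A X pick j := by
  simp only [winner, clearTime_truncateService A X pick h]

theorem service_truncateService {j N : ℕ} (h : j < N) :
    service A (truncateService N X) pick j = service A X pick j := by
  simp only [service, winner_truncateService A X pick h.le]
  simp [truncateService, h]

end Truncation

end ForkEarlyCancel

/-! ### Independence tools -/

/-- Both hypotheses together say that the joint law is a triple product; the conclusion only
regroups it. -/
theorem indepFun_prodMk_left_of_right {Ω α β γ : Type*} [MeasurableSpace Ω] [MeasurableSpace α]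
    [MeasurableSpace β] [MeasurableSpace γ] {P : Measure Ω} [IsProbabilityMeasure P]
    {f : Ω → α} {g : Ω → β} {h : Ω → γ} (hf : Measurable f) (hg : Measurable g)
    (hh : Measurable h) (h₁ : IndepFun f (fun ω => (g ω, h ω)) P) (h₂ : IndepFun g h P) :
    IndepFun (fun ω => (f ω, g ω)) h P := by
  have := Measure.isProbabilityMeasure_map (μ := P) hf.aemeasurable
  have := Measure.isProbabilityMeasure_map (μ := P) hg.aemeasurable
  have := Measure.isProbabilityMeasure_map (μ := P) hh.aemeasurable
  have h₃ : IndepFun f g P := h₁.comp measurable_id measurable_fst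
  rw [indepFun_iff_map_prod_eq_prod_map_map (by fun_prop) (by fun_prop)] at h₁ h₂ h₃ ⊢
  apply MeasurableEquiv.prodAssoc.map_measurableEquiv_injective
  rw [Measure.map_map (by fun_prop) (by fun_prop), h₃, Measure.prodAssoc_prod, ← h₂, ← h₁]
  rfl

/-- A sequence each of whose terms has law `μ` and is independent of the pair of `Z` and the earlier
terms is independent of `Z` with joint law the infinite power of `μ`. -/
theorem measure_preimage_inter_eq_mul_infinitePi {Ω α : Type*} [MeasurableSpace Ω]
    [MeasurableSpace α] {P : Measure Ω} [IsProbabilityMeasure P] {μ : Measure ℝ}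
    [IsProbabilityMeasure μ] {Z : Ω → α} {S : ℕ → Ω → ℝ} (hZ : Measurable Z)
    (hS : ∀ j, Measurable (S j))
    (h : ∀ N (C : Set α) (t : ℕ → Set ℝ), MeasurableSet C → (∀ j, MeasurableSet (t j)) →
      P ((Z ⁻¹' C ∩ {ω | ∀ j < N, S j ω ∈ t j}) ∩ S N ⁻¹' t N) =
        P (Z ⁻¹' C ∩ {ω | ∀ j < N, S j ω ∈ t j}) * μ (t N))
    {C : Set α} (hC : MeasurableSet C) {T : Set (ℕ → ℝ)} (hT : MeasurableSet T) :
    P (Z ⁻¹' C ∩ (fun ω j => S j ω) ⁻¹' T) =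
      P (Z ⁻¹' C) * Measure.infinitePi (fun _ : ℕ => μ) T := by
  have hprod : ∀ (t : ℕ → Set ℝ), (∀ j, MeasurableSet (t j)) → ∀ N,
      P (Z ⁻¹' C ∩ {ω | ∀ j < N, S j ω ∈ t j}) = P (Z ⁻¹' C) * ∏ j ∈ Finset.range N, μ (t j) := by
    intro t ht N
    induction N with
    | zero => simp
    | succ N ih =>
      rw [Finset.prod_range_succ, ← mul_assoc, ← ih, ← h N C t hC ht]
      congr 1
      ext ω
      simp only [Set.mem_inter_iff, Set.mem_preimage, Set.mem_ofPred_eq, Nat.lt_succ_iff_lt_or_eq,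
        or_imp, forall_and, forall_eq, and_assoc]
  have hSm : Measurable fun ω j => S j ω := measurable_pi_iff.2 hS
  have hCm := hZ hC
  -- Conditioning on the event needs positive probability; the null case is trivial.
  by_cases h0 : P (Z ⁻¹' C) = 0
  · rw [h0, zero_mul]
    exact measure_mono_null Set.inter_subset_left h0
  have hcond : (P[|Z ⁻¹' C]).map (fun ω j => S j ω) = Measure.infinitePi fun _ : ℕ => μ := by
    refine Measure.eq_infinitePi _ fun s t ht => ?_
    obtain ⟨N, hN⟩ := s.exists_nat_subset_range
    classical
    -- Padding with the whole line turns a cylinder over `s` into one over an initial segment, where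
    -- `hprod` applies.
    set t' : ℕ → Set ℝ := fun j => if j ∈ s then t j else Set.univ with ht'
    have htm : ∀ j, MeasurableSet (t' j) := fun j => by
      simp only [ht']
      split_ifs
      exacts [ht j, MeasurableSet.univ]
    have hpre : (fun ω j => S j ω) ⁻¹' (Set.pi s t) = {ω | ∀ j < N, S j ω ∈ t' j} := by
      ext ω
      simp only [ht', Set.mem_preimage, Set.mem_pi, Set.mem_ofPred_eq, SetLike.mem_coe]
      refine ⟨fun hω j _ => ?_, fun hω j hj => ?_⟩
      · split_ifs with hj
        exacts [hω j hj, Set.mem_univ _]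
      · simpa [hj] using hω j (Finset.mem_range.1 (hN hj))
    rw [Measure.map_apply hSm (MeasurableSet.pi s.countable_toSet fun j _ => ht j), hpre,
      cond_apply hCm, hprod t' htm N, ← mul_assoc, ENNReal.inv_mul_cancel h0 (measure_ne_top _ _),
      one_mul]
    rw [← Finset.prod_subset hN fun j _ hj => by simp [ht', hj]]
    exact Finset.prod_congr rfl fun j hj => by simp [ht', hj]
  rw [← hcond, Measure.map_apply hSm hT, cond_apply hCm, ← mul_assoc,
    ENNReal.mul_inv_cancel h0 (measure_ne_top _ _), one_mul]

/-! ### Law of the retained service times -/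

section Service

/-- Arrivals, choices and service times along a sample path. -/
abbrev ForkData (n : ℕ) : Type :=
  ((ℕ → ℝ) × (ℕ → Finset (Fin n) → Fin n)) × (ℕ → Fin n → ℝ)

variable {Ω : Type*} [MeasurableSpace Ω] {P : Measure Ω} {n : ℕ} {μ : Measure ℝ} {A : ℕ → Ω → ℝ} {X : ℕ → Fin n → Ω → ℝ}
  {pick : ℕ → Ω → Finset (Fin n) → Fin n}

/-- The service time of job `j` on its retained server. -/
noncomputable def forkService [NeZero n] (A : ℕ → Ω → ℝ) (X : ℕ → Fin n → Ω → ℝ)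
    (pick : ℕ → Ω → Finset (Fin n) → Fin n) (j : ℕ) (ω : Ω) : ℝ :=
  ForkEarlyCancel.service (fun j => A j ω) (fun j i => X j i ω) (fun j => pick j ω) j

namespace IsForkEarlyCancelInput

theorem measurable_forkService [NeZero n] (hF : IsForkEarlyCancelInput P μ A X pick) (j : ℕ) :
    Measurable (forkService A X pick j) :=
  ForkEarlyCancel.measurable_service hF.measurable_arrival hF.measurable_service
    hF.measurable_pick j

/-- The arrivals, the choices and the service times of the first `N` jobs are independent of each
service time of job `N`. -/
theorem indepFun_past [IsProbabilityMeasure P] (hF : IsForkEarlyCancelInput P μ A X pick) (N : ℕ) (i : Fin n) :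
    IndepFun (fun ω => (((fun j => A j ω : ℕ → ℝ), (fun j => pick j ω)),
      ForkEarlyCancel.truncateService N fun j i => X j i ω)) (X N i) P := by
  have hA : Measurable fun ω j => A j ω := measurable_pi_iff.2 hF.measurable_arrival
  have hp : Measurable fun ω j => pick j ω := measurable_pi_iff.2 hF.measurable_pick
  have hX : Measurable fun ω j i => X j i ω :=
    measurable_pi_iff.2 fun j => measurable_pi_iff.2 (hF.measurable_service j)
  have ht : Measurable (ForkEarlyCancel.truncateService (n := n) N) := by
    refine measurable_pi_iff.2 fun j => measurable_pi_iff.2 fun i => ?_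
    unfold ForkEarlyCancel.truncateService
    split_ifs <;> fun_prop
  have h₁ : IndepFun (fun ω => ((fun j => A j ω : ℕ → ℝ), (fun j => pick j ω)))
      (fun ω j i => X j i ω) P :=
    indepFun_prodMk_left_of_right hA hp hX
      (hF.indep_arrival.comp measurable_id measurable_swap) hF.indep_service_pick.symm
  have h₂ : IndepFun (fun ω => ForkEarlyCancel.truncateService N fun j i => X j i ω) (X N i) P := by
    have h := hF.indep_service.indepFun_finset (Finset.range N ×ˢ Finset.univ) {(N, i)}
      (by simp) fun q => hF.measurable_service q.1 q.2
    have hφ : Measurable fun (x : (Finset.range N ×ˢ (Finset.univ : Finset (Fin n)) :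
        Finset (ℕ × Fin n)) → ℝ) (j : ℕ) (i : Fin n) =>
        if hj : j < N then x ⟨(j, i), by simpa using hj⟩ else 0 := by
      refine measurable_pi_iff.2 fun j => measurable_pi_iff.2 fun i => ?_
      split_ifs <;> fun_prop
    have hψ : Measurable fun (x : ({(N, i)} : Finset (ℕ × Fin n)) → ℝ) =>
        x ⟨(N, i), by simp⟩ := by fun_prop
    exact h.comp hφ hψ
  refine indepFun_prodMk_left_of_right (hA.prodMk hp) (ht.comp hX) (hF.measurable_service N i) ?_ h₂
  exact h₁.comp measurable_id
    (ht.prodMk ((measurable_pi_apply i).comp (measurable_pi_apply N)))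

variable [IsProbabilityMeasure P] [NeZero n]

theorem measure_inter_forkService (hF : IsForkEarlyCancelInput P μ A X pick) (N : ℕ)
    {C : Set (ℕ → ℝ)} {t : ℕ → Set ℝ} (hC : MeasurableSet C) (ht : ∀ j, MeasurableSet (t j)) :
    P (((fun ω j => A j ω) ⁻¹' C ∩ {ω | ∀ j < N, forkService A X pick j ω ∈ t j}) ∩
        forkService A X pick N ⁻¹' t N) =
      P ((fun ω j => A j ω) ⁻¹' C ∩ {ω | ∀ j < N, forkService A X pick j ω ∈ t j}) * μ (t N) := by
  set E := (fun ω j => A j ω) ⁻¹' C ∩ {ω | ∀ j < N, forkService A X pick j ω ∈ t j} with hE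
  set w : Ω → Fin n := fun ω =>
    ForkEarlyCancel.winner (fun j => A j ω) (fun j i => X j i ω) (fun j => pick j ω) N with hw
  have hA : Measurable fun ω j => A j ω := measurable_pi_iff.2 hF.measurable_arrival
  have hEm : MeasurableSet E := (hA hC).inter <| by
    simp only [Set.ofPred_forall]
    exact MeasurableSet.iInter fun j => MeasurableSet.iInter fun _ =>
      hF.measurable_forkService j (ht j)
  have hwm : Measurable w := ForkEarlyCancel.measurable_winner hF.measurable_arrival
    hF.measurable_service hF.measurable_pick N
  -- On the event that server `i` is retained, the random index is frozen and `forkService` at `N`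
  -- is `X N i`.
  have split (B : Set Ω) (hB : MeasurableSet B) : P B = ∑ i, P (B ∩ w ⁻¹' {i}) := by
    rw [← measure_biUnion_finset]
    · congr 1
      ext ω
      simp
    · intro i _ k _ hik
      refine Set.disjoint_left.2 fun ω h1 h2 => hik ?_
      rw [← h1.2, ← h2.2]
    · exact fun i _ => hB.inter (hwm (measurableSet_singleton i))
  rw [split _ (hEm.inter (hF.measurable_forkService N (ht N))), split E hEm, Finset.sum_mul]
  refine Finset.sum_congr rfl fun i _ => ?_
  have hset : E ∩ forkService A X pick N ⁻¹' t N ∩ w ⁻¹' {i} =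
      (E ∩ w ⁻¹' {i}) ∩ X N i ⁻¹' t N := by
    ext ω
    simp only [Set.mem_inter_iff, Set.mem_preimage, Set.mem_singleton_iff]
    have : w ω = i → (forkService A X pick N ω = X N i ω) := by
      rintro rfl
      rfl
    constructor
    · rintro ⟨⟨h1, h2⟩, h3⟩
      exact ⟨⟨h1, h3⟩, this h3 ▸ h2⟩
    · rintro ⟨⟨h1, h3⟩, h2⟩
      exact ⟨⟨h1, (this h3).symm ▸ h2⟩, h3⟩
  let G : Ω → ForkData n := fun ω =>
    ((fun j => A j ω, fun j => pick j ω),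
      ForkEarlyCancel.truncateService N fun j i => X j i ω)
  let D : Set (ForkData n) :=
    {z | z.1.1 ∈ C} ∩ {z | ∀ j < N, ForkEarlyCancel.service z.1.1 z.2 z.1.2 j ∈ t j} ∩
      {z | ForkEarlyCancel.winner z.1.1 z.2 z.1.2 N = i}
  have hD : MeasurableSet D := by
    refine (MeasurableSet.inter ?_ ?_).inter ?_
    · exact (measurable_fst.comp measurable_fst) hC
    · simp only [Set.ofPred_forall]
      exact MeasurableSet.iInter fun j => MeasurableSet.iInter fun _ =>
        ForkEarlyCancel.measurable_service (Ω := ForkData n) (A := fun j z => z.1.1 j)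
          (X := fun j i z => z.2 j i) (pick := fun j z => z.1.2 j) (by fun_prop) (by fun_prop)
          (by fun_prop) j (ht j)
    · exact ForkEarlyCancel.measurable_winner (Ω := ForkData n) (A := fun j z => z.1.1 j)
        (X := fun j i z => z.2 j i) (pick := fun j z => z.1.2 j) (by fun_prop) (by fun_prop)
        (by fun_prop) N (measurableSet_singleton i)
  -- By non-anticipation the past event and the retained server depend on truncated data only, which
  -- `indepFun_past` makes independent of `X N i`.
  have hG : E ∩ w ⁻¹' {i} = G ⁻¹' D := by
    ext ω
    have h1 : ForkEarlyCancel.winner (G ω).1.1 (G ω).2 (G ω).1.2 N = w ω :=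
      ForkEarlyCancel.winner_truncateService _ _ _ le_rfl
    have h2 : (∀ j < N, ForkEarlyCancel.service (G ω).1.1 (G ω).2 (G ω).1.2 j ∈ t j) ↔
        ∀ j < N, forkService A X pick j ω ∈ t j :=
      forall₂_congr fun j hj => by
        rw [show ForkEarlyCancel.service (G ω).1.1 (G ω).2 (G ω).1.2 j = forkService A X pick j ω
          from ForkEarlyCancel.service_truncateService _ _ _ hj]
    simp only [hE, D, Set.mem_inter_iff, Set.mem_preimage, Set.mem_ofPred_eq, h1, h2,
      Set.mem_singleton_iff]
    rfl
  rw [hset, hG, (hF.indepFun_past N i).measure_inter_preimage_eq_mul _ _ hD (ht N),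
    ← Measure.map_apply (hF.measurable_service N i) (ht N), hF.law_service]

variable [IsProbabilityMeasure μ]

theorem measure_inter_forkService_mem (hF : IsForkEarlyCancelInput P μ A X pick)
    {C T : Set (ℕ → ℝ)} (hC : MeasurableSet C) (hT : MeasurableSet T) :
    P ((fun ω j => A j ω) ⁻¹' C ∩ (fun ω j => forkService A X pick j ω) ⁻¹' T) =
      P ((fun ω j => A j ω) ⁻¹' C) * Measure.infinitePi (fun _ : ℕ => μ) T :=
  measure_preimage_inter_eq_mul_infinitePi (measurable_pi_iff.2 hF.measurable_arrival)
    hF.measurable_forkService (fun N _ _ hC ht => hF.measure_inter_forkService N hC ht) hC hT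

theorem map_forkService (hF : IsForkEarlyCancelInput P μ A X pick) :
    P.map (fun ω j => forkService A X pick j ω) = Measure.infinitePi fun _ : ℕ => μ := by
  ext T hT
  rw [Measure.map_apply (measurable_pi_iff.2 hF.measurable_forkService) hT]
  simpa using hF.measure_inter_forkService_mem MeasurableSet.univ hT

theorem indepFun_forkService (hF : IsForkEarlyCancelInput P μ A X pick) :
    IndepFun (fun ω j => A j ω) (fun ω j => forkService A X pick j ω) P := by
  refine indepFun_iff_measure_inter_preimage_eq_mul.2 fun C T hC hT => ?_
  rw [hF.measure_inter_forkService_mem hC hT, ← hF.map_forkService,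
    Measure.map_apply (measurable_pi_iff.2 hF.measurable_forkService) hT]

theorem map_forkService_apply (hF : IsForkEarlyCancelInput P μ A X pick) (j : ℕ) :
    P.map (forkService A X pick j) = μ := by
  have h := congrArg (Measure.map fun s : ℕ → ℝ => s j) hF.map_forkService
  rw [Measure.map_map (measurable_pi_apply j) (measurable_pi_iff.2 hF.measurable_forkService),
    Measure.infinitePi_map_eval] at h
  exact h

end IsForkEarlyCancelInput

end Service

/-! ### The queue history as a measurable function of its input -/

namespace ForkEarlyCancel

variable {n : ℕ} [NeZero n]

/-- The rule that retains the task on the first of the tied servers. -/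
def pickMin (s : Finset (Fin n)) : Fin n := if h : s.Nonempty then s.min' h else 0

theorem pickMin_mem {s : Finset (Fin n)} (h : s.Nonempty) : pickMin s ∈ s := by
  simp [pickMin, h, s.min'_mem h]

/-- The history of the fork-early-cancel system with the same service time `S j` on all servers and
the tie-breaking rule `pickMin`. -/
noncomputable def minHistory (n : ℕ) [NeZero n] (z : (ℕ → ℝ) × (ℕ → ℝ)) : ℕ → ℝ × ℝ × ℝ := fun j =>
  (z.1 j, start z.1 (fun j (_ : Fin n) => z.2 j) (fun _ => pickMin) j,
    departure z.1 (fun j (_ : Fin n) => z.2 j) (fun _ => pickMin) j)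

theorem measurable_minHistory : Measurable (minHistory n) := by
  refine measurable_pi_iff.2 fun j => Measurable.prodMk (by fun_prop) (Measurable.prodMk ?_ ?_)
  · exact measurable_start (Ω := (ℕ → ℝ) × (ℕ → ℝ)) (A := fun j z => z.1 j)
      (X := fun j _ z => z.2 j) (pick := fun _ _ => pickMin) (by fun_prop) (by fun_prop)
      (by fun_prop) j
  · exact measurable_departure (Ω := (ℕ → ℝ) × (ℕ → ℝ)) (A := fun j z => z.1 j)
      (X := fun j _ z => z.2 j) (pick := fun _ _ => pickMin) (by fun_prop) (by fun_prop)
      (by fun_prop) j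

end ForkEarlyCancel

section History

variable {Ω Ω' : Type*} [MeasurableSpace Ω] [MeasurableSpace Ω'] {P : Measure Ω} {P' : Measure Ω'}
  {n : ℕ} [NeZero n] {A S : ℕ → Ω → ℝ} {A' S' : ℕ → Ω' → ℝ}

/-- The pathwise comparison is read backwards: any queue is a fork system with equal service times
on all servers. This replaces the recursive infimum by a visibly measurable expression. -/
theorem queueHistory_ae_eq (hA : ∀ᵐ ω ∂P, ∀ j, 0 ≤ A j ω) (hS : ∀ᵐ ω ∂P, ∀ j, 0 ≤ S j ω) :
    queueHistory n A S =ᵐ[P]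
      fun ω => ForkEarlyCancel.minHistory n (fun j => A j ω, fun j => S j ω) := by
  filter_upwards [hA, hS] with ω hA hS
  have h := ForkEarlyCancel.start_eq_queue_start (n := n) (X := fun j _ => S j ω)
    (pick := fun _ => ForkEarlyCancel.pickMin) hA (fun j _ => hS j)
    fun _ _ => ForkEarlyCancel.pickMin_mem
  ext1 j
  simp only [queueHistory, ForkEarlyCancel.minHistory, MultiServerQueue.departure,
    ForkEarlyCancel.departure_eq, ← h]
  rfl

/-- The law of the history of the queue is determined by the joint law of arrivals and services. -/
theorem identDistrib_queueHistory
    (h : IdentDistrib (fun ω => ((fun j => A j ω : ℕ → ℝ), (fun j => S j ω : ℕ → ℝ)))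
      (fun ω => ((fun j => A' j ω : ℕ → ℝ), (fun j => S' j ω : ℕ → ℝ))) P P')
    (hA : ∀ᵐ ω ∂P, ∀ j, 0 ≤ A j ω) (hS : ∀ᵐ ω ∂P, ∀ j, 0 ≤ S j ω) :
    IdentDistrib (queueHistory n A S) (queueHistory n A' S') P P' := by
  have hm : MeasurableSet {z : (ℕ → ℝ) × (ℕ → ℝ) | (∀ j, 0 ≤ z.1 j) ∧ ∀ j, 0 ≤ z.2 j} := by
    simp only [Set.ofPred_and, Set.ofPred_forall]
    refine (MeasurableSet.iInter fun j => ?_).inter (MeasurableSet.iInter fun j => ?_) <;>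
      exact measurableSet_le measurable_const (by fun_prop)
  -- Nonnegativity is a measurable property of the input, so it passes to the second system through
  -- equality of laws.
  have h' := h.ae_snd hm (hA.and hS)
  have hc := h.comp (ForkEarlyCancel.measurable_minHistory (n := n))
  refine (IdentDistrib.of_ae_eq hc.aemeasurable_fst (queueHistory_ae_eq hA hS).symm).symm.trans
    (hc.trans (IdentDistrib.of_ae_eq hc.aemeasurable_snd ?_))
  exact (queueHistory_ae_eq (h'.mono fun _ h => h.1) (h'.mono fun _ h => h.2)).symm

end History

/-! ### Almost sure identification with a queue -/

section Fork

variable {Ω : Type*} [MeasurableSpace Ω] {P : Measure Ω} {n : ℕ} {μ : Measure ℝ}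
  {A : ℕ → Ω → ℝ} {X : ℕ → Fin n → Ω → ℝ} {pick : ℕ → Ω → Finset (Fin n) → Fin n}

namespace IsForkEarlyCancelInput

theorem ae_arrival_nonneg (hF : IsForkEarlyCancelInput P μ A X pick) :
    ∀ᵐ ω ∂P, ∀ j, 0 ≤ A j ω := by
  filter_upwards [hF.arrival_nonneg, hF.arrival_mono] with ω h0 hm j
  exact h0.trans (hm j.zero_le)

theorem ae_service_nonneg (hμ : ∀ᵐ x ∂μ, 0 < x) (hF : IsForkEarlyCancelInput P μ A X pick) :
    ∀ᵐ ω ∂P, ∀ j i, 0 ≤ X j i ω := by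
  refine ae_all_iff.2 fun j => ae_all_iff.2 fun i => ?_
  rw [← hF.law_service j i] at hμ
  exact (ae_of_ae_map (hF.measurable_service j i).aemeasurable hμ).mono fun _ h => h.le

theorem ae_pick_mem (hF : IsForkEarlyCancelInput P μ A X pick) :
    ∀ᵐ ω ∂P, ∀ j (s : Finset (Fin n)), s.Nonempty → pick j ω s ∈ s := by
  refine ae_all_iff.2 fun j => ae_all_iff.2 fun s => ?_
  by_cases hs : s.Nonempty
  · have hm : Measurable fun ω => pick j ω s := measurable_pi_iff.1 (hF.measurable_pick j) s
    have h : ∀ᵐ i ∂(P.map fun ω => pick j ω s), i ∈ s := by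
      rw [hF.law_pick j s hs]
      exact (ae_cond_mem (μ := Measure.count) (Set.toFinite (s : Set (Fin n))).measurableSet)
    exact (ae_of_ae_map hm.aemeasurable h).mono fun _ h _ => h
  · exact Eventually.of_forall fun _ h => absurd h hs

variable [NeZero n]

/-- The fork-early-cancel system is the queue fed with the service times of the retained tasks. -/
theorem forkHistory_ae_eq (hμ : ∀ᵐ x ∂μ, 0 < x) (hF : IsForkEarlyCancelInput P μ A X pick) :
    forkHistory A X pick =ᵐ[P] queueHistory n A (forkService A X pick) := by
  filter_upwards [hF.ae_arrival_nonneg, hF.ae_service_nonneg hμ, hF.ae_pick_mem] with ω hA hX hp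
  ext1 j
  have h := ForkEarlyCancel.start_eq_queue_start hA hX hp j
  simp only [forkHistory, queueHistory, MultiServerQueue.departure, ForkEarlyCancel.departure_eq,
    ← h]
  rfl

theorem ae_forkService_nonneg (hμ : ∀ᵐ x ∂μ, 0 < x)
    (hF : IsForkEarlyCancelInput P μ A X pick) :
    ∀ᵐ ω ∂P, ∀ j, 0 ≤ forkService A X pick j ω :=
  (hF.ae_service_nonneg hμ).mono fun _ h j => h j _

end IsForkEarlyCancelInput

end Fork

/-! ### Poisson arrivals -/

section Poisson

variable {Ω Ω' : Type*} [MeasurableSpace Ω] [MeasurableSpace Ω'] {P : Measure Ω} {P' : Measure Ω'}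
  {lam : ℝ} {A : ℕ → Ω → ℝ} {A' : ℕ → Ω' → ℝ}

theorem sum_interarrival {Ω : Type*} (A : ℕ → Ω → ℝ) (j : ℕ) (ω : Ω) :
    ∑ l ∈ Finset.range (j + 1), interarrival A l ω = A j ω := by
  induction j with
  | zero => simp [interarrival]
  | succ j ih => rw [Finset.sum_range_succ, ih]; simp [interarrival]

theorem measurable_interarrival (hA : ∀ j, Measurable (A j)) (j : ℕ) :
    Measurable (interarrival A j) := by
  cases j with
  | zero => exact hA 0
  | succ j => exact (hA (j + 1)).sub (hA j)

theorem IsPoissonArrivals.map_interarrival (h : IsPoissonArrivals P lam A) :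
    P.map (fun ω j => interarrival A j ω) = Measure.infinitePi fun _ : ℕ => expMeasure lam := by
  rw [h.indep.map_fun_eq_infinitePi_map (measurable_interarrival h.measurable)]
  simp only [h.law]

/-- The law of the points of a Poisson process is determined by its rate. -/
theorem IsPoissonArrivals.identDistrib (h : IsPoissonArrivals P lam A)
    (h' : IsPoissonArrivals P' lam A') :
    IdentDistrib (fun ω j => A j ω) (fun ω j => A' j ω) P P' := by
  have hd : IdentDistrib (fun ω j => interarrival A j ω) (fun ω j => interarrival A' j ω) P P' :=
    ⟨(measurable_pi_iff.2 (measurable_interarrival h.measurable)).aemeasurable,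
      (measurable_pi_iff.2 (measurable_interarrival h'.measurable)).aemeasurable,
      h.map_interarrival.trans h'.map_interarrival.symm⟩
  have hu : Measurable fun (x : ℕ → ℝ) (j : ℕ) => ∑ l ∈ Finset.range (j + 1), x l := by fun_prop
  simpa only [Function.comp_def, sum_interarrival] using hd.comp hu

end Poisson

/-! ### Equivalence of the systems and conclusions -/

theorem IsForkEarlyCancelInput.identDistrib_history {Ω Ω' : Type*} [MeasurableSpace Ω]
    [MeasurableSpace Ω'] {P : Measure Ω} [IsProbabilityMeasure P] {P' : Measure Ω'}
    [IsProbabilityMeasure P'] {n : ℕ} [NeZero n] {μ : Measure ℝ} [IsProbabilityMeasure μ]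
    (hμ : ∀ᵐ x ∂μ, 0 < x) {A : ℕ → Ω → ℝ} {X : ℕ → Fin n → Ω → ℝ}
    {pick : ℕ → Ω → Finset (Fin n) → Fin n} (hF : IsForkEarlyCancelInput P μ A X pick) {lam : ℝ}
    (hA : IsPoissonArrivals P lam A) {A' S' : ℕ → Ω' → ℝ} (hQ : IsMGInput P' lam μ A' S') :
    IdentDistrib (forkHistory A X pick) (queueHistory n A' S') P P' := by
  have hAm : Measurable fun ω j => A j ω := measurable_pi_iff.2 hA.measurable
  have hSm := measurable_pi_iff.2 hF.measurable_forkService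
  have hAm' : Measurable fun ω j => A' j ω := measurable_pi_iff.2 hQ.poisson.measurable
  have hSm' : Measurable fun ω j => S' j ω := measurable_pi_iff.2 hQ.measurable_service
  have hS : IdentDistrib (fun ω j => forkService A X pick j ω) (fun ω j => S' j ω) P P' := by
    refine ⟨hSm.aemeasurable, hSm'.aemeasurable, ?_⟩
    rw [hF.map_forkService, hQ.indep_service.map_fun_eq_infinitePi_map hQ.measurable_service]
    simp only [hQ.law_service]
  have hjoint : IdentDistrib
      (fun ω => ((fun j => A j ω : ℕ → ℝ), (fun j => forkService A X pick j ω : ℕ → ℝ)))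
      (fun ω => ((fun j => A' j ω : ℕ → ℝ), (fun j => S' j ω : ℕ → ℝ))) P P' := by
    refine ⟨(hAm.prodMk hSm).aemeasurable, (hAm'.prodMk hSm').aemeasurable, ?_⟩
    rw [hF.indepFun_forkService.map_prod_eq_prod_map_map hAm.aemeasurable hSm.aemeasurable,
      hQ.indep_arrival.map_prod_eq_prod_map_map hAm'.aemeasurable hSm'.aemeasurable,
      (hA.identDistrib hQ.poisson).map_eq, hS.map_eq]
  have hq := identDistrib_queueHistory (n := n) hjoint hF.ae_arrival_nonneg
    (hF.ae_forkService_nonneg hμ)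
  exact (IdentDistrib.of_ae_eq hq.aemeasurable_fst (hF.forkHistory_ae_eq hμ).symm).symm.trans hq

theorem longRunMean_of_mean_eq {Ω : Type*} [MeasurableSpace Ω] {P : Measure Ω} {Y : ℕ → Ω → ℝ}
    {m : ℝ≥0∞} (h : ∀ j, mean P (Y j) = m) : longRunMean P Y = m := by
  have h' : (fun N : ℕ => (∑ j ∈ Finset.range N, mean P (Y j)) / (N : ℝ≥0∞)) =ᶠ[atTop]
      fun _ => m := by
    -- The average over `N = 0` jobs is `0 / 0 = 0` and has to be discarded.
    filter_upwards [eventually_ge_atTop 1] with N hN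
    have hN' : (N : ℝ≥0∞) ≠ 0 := by exact_mod_cast (Nat.one_le_iff_ne_zero.1 hN)
    simp only [h, Finset.sum_const, Finset.card_range, nsmul_eq_mul]
    rw [mul_comm, ENNReal.mul_div_cancel_right hN' (ENNReal.natCast_ne_top N)]
  rw [longRunMean, limsup_congr h', limsup_const]

theorem mainTheorem4 {Ω Ω' : Type*} [MeasurableSpace Ω] [MeasurableSpace Ω']
    (P : Measure Ω) [IsProbabilityMeasure P] (P' : Measure Ω') [IsProbabilityMeasure P']
    (n : ℕ) [NeZero n] (μ : Measure ℝ) [IsProbabilityMeasure μ] (hμ : ∀ᵐ x ∂μ, 0 < x)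
    (A : ℕ → Ω → ℝ) (X : ℕ → Fin n → Ω → ℝ) (pick : ℕ → Ω → Finset (Fin n) → Fin n)
    (hF : IsForkEarlyCancelInput P μ A X pick) :
    -- the cost, for any arrival process
    (∀ j, mean P (forkCost A X pick j) = mean μ fun x => x) ∧
    longRunMean P (forkCost A X pick) = (mean μ fun x => x) ∧
    -- the equivalence with the `M/G/n` queue and the latency, for Poisson arrivals
    (∀ lam : ℝ, 0 < lam → IsPoissonArrivals P lam A →
      ∀ A' S' : ℕ → Ω' → ℝ, IsMGInput P' lam μ A' S' →
        IdentDistrib (forkHistory A X pick) (queueHistory n A' S') P P' ∧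
        (∀ j, mean P (forkLatency A X pick j) = mean P' (queueResponse n A' S' j)) ∧
        longRunMean P (forkLatency A X pick) = longRunMean P' (queueResponse n A' S') ∧
        ∀ ν : Measure ℝ, IsSteadyStateLaw P (forkLatency A X pick) ν ↔
          IsSteadyStateLaw P' (queueResponse n A' S') ν) := by

  have hcost : ∀ j, mean P (forkCost A X pick j) = mean μ fun x => x := fun j => by
    have h : forkCost A X pick j = forkService A X pick j :=
      funext fun ω => ForkEarlyCancel.cost_eq_service _ _ _ j
    rw [mean, mean, h, ← hF.map_forkService_apply j,
      lintegral_map (by fun_prop) (hF.measurable_forkService j)]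
  refine ⟨hcost, longRunMean_of_mean_eq hcost, fun lam _ hA A' S' hQ => ?_⟩
  have hH := hF.identDistrib_history hμ hA hQ
  have hT (j : ℕ) : IdentDistrib (forkLatency A X pick j) (queueResponse n A' S' j) P P' :=
    hH.comp (u := fun z : ℕ → ℝ × ℝ × ℝ => (z j).2.2 - (z j).1) (by fun_prop)
  have hmean (j : ℕ) : mean P (forkLatency A X pick j) = mean P' (queueResponse n A' S' j) :=
    ((hT j).comp ENNReal.measurable_ofReal).lintegral_eq
  refine ⟨hH, hmean, by simp only [longRunMean, hmean], fun ν => ?_⟩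
  have hint (f : ℝ →ᵇ ℝ) (j : ℕ) :
      ∫ ω, f (forkLatency A X pick j ω) ∂P = ∫ ω, f (queueResponse n A' S' j ω) ∂P' :=
    ((hT j).comp f.continuous.measurable).integral_eq
  simp only [IsSteadyStateLaw, hint]
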